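/- Let $a\in\mathbb{Q}$ be such that $f(x)=x^8+ax^4+1$ is irreducible over $\mathbb{Q}$, and let $\mathbb{Q}^2=\{k^2 : k\in\mathbb{Q}\}$. Let $\mathrm{Gal}(f)$ be the Galois group of $f$ over $\mathbb{Q}$, regarded as a permutation group on the eight roots of $f$ and hence, after numbering the roots by $0,\dots,7$, as a transitive subgroup of the symmetric group on $\{0,\dots,7\}$, well defined up to conjugacy. Write 8T$j$ for the $j$-th conjugacy class of transitive subgroups of $S_8$ in the classification of Butler and McKay. In particular, these are the conjugacy classes of the following groups: - 8T2: $\langle (0\,1\,2\,7)(3\,4\,5\,6),\ (0\,4)(1\,5)(2\,6)(3\,7)\rangle$, the regular representation of $C_4\times C_2$; - 8T3: $\langle (0\,7)(1\,2)(3\,4)(5\,6),\ (0\,2)(1\,7)(3\,5)(4\,6),\ (0\,4)(1\,5)(2\,6)(3\,7)\rangle$, the regular representation of the elementary abelian group of order $8$; - 8T4: $\langle (0\,1\,2\,7)(3\,4\,5\,6),\ (0\,5)(1\,4)(2\,3)(6\,7)\rangle$, the regular representation of the dihedral group of order $8$; - 8T9: the group generated by the three generators of 8T3 above together with $(3\,4)(5\,6)$,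 which has order $16$ and is isomorphic to the direct product of the dihedral group of order $8$ with $C_2$. Then $\mathrm{Gal}(f)$ is 1. 8T3 if $a+2\in\mathbb{Q}^2$; 2. 8T4 if $a+2\notin\mathbb{Q}^2$ and $a-2\in\mathbb{Q}^2$; 3. 8T2 if $a+2\notin\mathbb{Q}^2$, $a-2\notin\mathbb{Q}^2$ and $4-a^2\in\mathbb{Q}^2$; 4. 8T9 if $a+2\notin\mathbb{Q}^2$, $a-2\notin\mathbb{Q}^2$ and $4-a^2\notin\mathbb{Q}^2$. -/

import Mathlib

open Polynomial

/-- `HasGaloisType f G`: the Galois group of `f` over the field `K`, as a permutation group of the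
roots of `f` in its splitting field, is `G` after a suitable numbering `e` of the roots by
`0, …, n - 1`. Since `e` is arbitrary, this only depends on the conjugacy class of `G` in the
symmetric group. -/
def HasGaloisType {K : Type*} [Field K] {n : ℕ} (f : K[X])
    (G : Subgroup (Equiv.Perm (Fin n))) : Prop :=
  ∃ e : f.rootSet f.SplittingField ≃ Fin n,
    (MulAction.toPermHom f.Gal (f.rootSet f.SplittingField)).range.map
      e.permCongrHom.toMonoidHom = G

/-- The transitive group 8T2, the regular representation of `C₄ × C₂`. -/
def group8T2 : Subgroup (Equiv.Perm (Fin 8)) :=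
  Subgroup.closure
    {c[0, 1, 2, 7] * c[3, 4, 5, 6],
     c[0, 4] * c[1, 5] * c[2, 6] * c[3, 7]}

/-- The transitive group 8T3, the regular representation of the elementary abelian group of
order eight. -/
def group8T3 : Subgroup (Equiv.Perm (Fin 8)) :=
  Subgroup.closure
    {c[0, 7] * c[1, 2] * c[3, 4] * c[5, 6],
     c[0, 2] * c[1, 7] * c[3, 5] * c[4, 6],
     c[0, 4] * c[1, 5] * c[2, 6] * c[3, 7]}

/-- The transitive group 8T4, the regular representation of the dihedral group of order eight. -/
def group8T4 : Subgroup (Equiv.Perm (Fin 8)) :=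
  Subgroup.closure
    {c[0, 1, 2, 7] * c[3, 4, 5, 6],
     c[0, 5] * c[1, 4] * c[2, 3] * c[6, 7]}

/-- The transitive group 8T9, of order sixteen and isomorphic to `D₄ × C₂`, where `D₄` is the
dihedral group of order eight. -/
def group8T9 : Subgroup (Equiv.Perm (Fin 8)) :=
  Subgroup.closure
    {c[0, 7] * c[1, 2] * c[3, 4] * c[5, 6],
     c[0, 2] * c[1, 7] * c[3, 5] * c[4, 6],
     c[0, 4] * c[1, 5] * c[2, 6] * c[3, 7],
     c[3, 4] * c[5, 6]}

/-! With `α` a root and `i ^ 2 = -1` in the splitting field, the eight roots are `i ^ k * α ^ s`,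
`k` mod 4, `s = ±1`. An automorphism is therefore a triple `(ε, k, s)` in a group of order 16, and
irreducibility makes every pair `(k, s)` occur. The elements `i(α² - α⁻²)`, `i(α² + α⁻²)`, `i(α⁴ -
α⁻⁴)` have squares `a + 2`, `a - 2`, `4 - a²`, and automorphisms multiply them by the signs `ε(-1)^k
s`, `ε(-1)^k`, `ε s`. If one of these squares is a square in the base field, the matching sign is
always `1`; it then determines `ε` from `(k, s)`, so the Galois group is the whole kernel, of order
8 (`hasGaloisType_of_character`). Otherwise the group is everything or `ε` is a function of `(k,
s)`. A finite check (`exists_character_trivial`) shows that the latter makes `ε` or one of the three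
signs trivial, so that `-1`, `a + 2`, `a - 2` or `4 - a²` would be a square. -/

open Polynomial

/-! ### Finite computations with indices and the four permutation groups. -/

/-- The index of the root `i ^ k * α ^ s`. -/
abbrev RootIndex := ZMod 4 × ℤˣ

/-- The data `(ε, k, s)` of the automorphism with `i ↦ i ^ ε` and `α ↦ i ^ k * α ^ s`. -/
abbrev AutData := ℤˣ × ZMod 4 × ℤˣ

/-- The action of an automorphism on the indices of the roots. -/
def AutData.act (g : AutData) (p : RootIndex) : RootIndex :=
  (((g.1 : ℤ) : ZMod 4) * p.1 + ((p.2 : ℤ) : ZMod 4) * g.2.1, g.2.2 * p.2)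

/-- The parity character `k ↦ (-1) ^ k` of `ZMod 4`. -/
def paritySign (k : ZMod 4) : ℤˣ := (-1) ^ k.val

/-- `g` permutes the roots, numbered by `ν`, as an element of `G` does. -/
def AutData.ActsIn {n : ℕ} (g : AutData) (ν : Fin n → RootIndex)
    (G : Subgroup (Equiv.Perm (Fin n))) : Prop :=
  ∃ τ ∈ G, ∀ j, ν (τ j) = g.act (ν j)

/-- Each numbering is chosen so that the prescribed cycles become maps `AutData.act g`, with `g` in
the relevant kernel for the three groups of order 8. -/
def numbering8T3 : Fin 8 → RootIndex :=
  ![(0, 1), (1, 1), (2, 1), (0, -1), (1, -1), (2, -1), (3, -1), (3, 1)]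
def numbering8T4 : Fin 8 → RootIndex :=
  ![(0, 1), (1, -1), (2, 1), (1, 1), (0, -1), (3, 1), (2, -1), (3, -1)]
def numbering8T2 : Fin 8 → RootIndex :=
  ![(0, 1), (1, 1), (2, 1), (1, -1), (0, -1), (3, -1), (2, -1), (3, 1)]
def numbering8T9 : Fin 8 → RootIndex :=
  ![(0, 1), (0, -1), (2, -1), (1, 1), (3, 1), (1, -1), (3, -1), (2, 1)]

theorem numbering8T3_injective : Function.Injective numbering8T3 := by decide
theorem numbering8T4_injective : Function.Injective numbering8T4 := by decide
theorem numbering8T2_injective : Function.Injective numbering8T2 := by decide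
theorem numbering8T9_injective : Function.Injective numbering8T9 := by decide

theorem actsIn_group8T3 (g : AutData) (hg : g.1 * paritySign g.2.1 * g.2.2 = 1) :
    g.ActsIn numbering8T3 group8T3 := by
  -- Every element of the kernel acts as a product of powers of the generators in a fixed order, so
  -- membership in the closure reduces to a search over exponents.
  have key : ∀ g : AutData, g.1 * paritySign g.2.1 * g.2.2 = 1 → ∃ x y z : Fin 2, ∀ j,
      numbering8T3 (((c[0, 7] * c[1, 2] * c[3, 4] * c[5, 6]) ^ x.val *
        (c[0, 2] * c[1, 7] * c[3, 5] * c[4, 6]) ^ y.val *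
        (c[0, 4] * c[1, 5] * c[2, 6] * c[3, 7]) ^ z.val : Equiv.Perm (Fin 8)) j) =
      g.act (numbering8T3 j) := by decide +kernel
  obtain ⟨x, y, z, h⟩ := key g hg
  refine ⟨_, ?_, h⟩
  refine mul_mem (mul_mem ?_ ?_) ?_ <;> refine pow_mem (Subgroup.subset_closure ?_) _ <;> simp

theorem group8T3_generators (τ : Equiv.Perm (Fin 8))
    (hτ : τ ∈ ({c[0, 7] * c[1, 2] * c[3, 4] * c[5, 6],
     c[0, 2] * c[1, 7] * c[3, 5] * c[4, 6],
     c[0, 4] * c[1, 5] * c[2, 6] * c[3, 7]} : Set (Equiv.Perm (Fin 8)))) :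
    ∃ g : AutData, g.1 * paritySign g.2.1 * g.2.2 = 1 ∧
      ∀ j, numbering8T3 (τ j) = g.act (numbering8T3 j) := by
  rcases hτ with rfl | rfl | rfl <;> decide +kernel

theorem actsIn_group8T4 (g : AutData) (hg : g.1 * paritySign g.2.1 = 1) :
    g.ActsIn numbering8T4 group8T4 := by
  have key : ∀ g : AutData, g.1 * paritySign g.2.1 = 1 → ∃ (x : Fin 4) (y : Fin 2), ∀ j,
      numbering8T4 (((c[0, 1, 2, 7] * c[3, 4, 5, 6]) ^ x.val *
        (c[0, 5] * c[1, 4] * c[2, 3] * c[6, 7]) ^ y.val : Equiv.Perm (Fin 8)) j) =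
      g.act (numbering8T4 j) := by decide +kernel
  obtain ⟨x, y, h⟩ := key g hg
  refine ⟨_, ?_, h⟩
  refine mul_mem ?_ ?_ <;> refine pow_mem (Subgroup.subset_closure ?_) _ <;> simp

theorem group8T4_generators (τ : Equiv.Perm (Fin 8))
    (hτ : τ ∈ ({c[0, 1, 2, 7] * c[3, 4, 5, 6],
     c[0, 5] * c[1, 4] * c[2, 3] * c[6, 7]} : Set (Equiv.Perm (Fin 8)))) :
    ∃ g : AutData, g.1 * paritySign g.2.1 = 1 ∧
      ∀ j, numbering8T4 (τ j) = g.act (numbering8T4 j) := by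
  rcases hτ with rfl | rfl <;> decide +kernel

theorem actsIn_group8T2 (g : AutData) (hg : g.1 * g.2.2 = 1) :
    g.ActsIn numbering8T2 group8T2 := by
  have key : ∀ g : AutData, g.1 * g.2.2 = 1 → ∃ (x : Fin 4) (y : Fin 2), ∀ j,
      numbering8T2 (((c[0, 1, 2, 7] * c[3, 4, 5, 6]) ^ x.val *
        (c[0, 4] * c[1, 5] * c[2, 6] * c[3, 7]) ^ y.val : Equiv.Perm (Fin 8)) j) =
      g.act (numbering8T2 j) := by decide +kernel
  obtain ⟨x, y, h⟩ := key g hg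
  refine ⟨_, ?_, h⟩
  refine mul_mem ?_ ?_ <;> refine pow_mem (Subgroup.subset_closure ?_) _ <;> simp

theorem group8T2_generators (τ : Equiv.Perm (Fin 8))
    (hτ : τ ∈ ({c[0, 1, 2, 7] * c[3, 4, 5, 6],
     c[0, 4] * c[1, 5] * c[2, 6] * c[3, 7]} : Set (Equiv.Perm (Fin 8)))) :
    ∃ g : AutData, g.1 * g.2.2 = 1 ∧
      ∀ j, numbering8T2 (τ j) = g.act (numbering8T2 j) := by
  rcases hτ with rfl | rfl <;> decide +kernel

theorem actsIn_group8T9 (g : AutData) : g.ActsIn numbering8T9 group8T9 := by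
  have key : ∀ g : AutData, ∃ x y z w : Fin 2, ∀ j,
      numbering8T9 (((c[0, 7] * c[1, 2] * c[3, 4] * c[5, 6]) ^ x.val *
        (c[0, 2] * c[1, 7] * c[3, 5] * c[4, 6]) ^ y.val *
        (c[0, 4] * c[1, 5] * c[2, 6] * c[3, 7]) ^ z.val *
        (c[3, 4] * c[5, 6]) ^ w.val : Equiv.Perm (Fin 8)) j) =
      g.act (numbering8T9 j) := by decide +kernel
  obtain ⟨x, y, z, w, h⟩ := key g
  refine ⟨_, ?_, h⟩
  refine mul_mem (mul_mem (mul_mem ?_ ?_) ?_) ?_ <;>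
    refine pow_mem (Subgroup.subset_closure ?_) _ <;> simp

theorem group8T9_generators (τ : Equiv.Perm (Fin 8))
    (hτ : τ ∈ ({c[0, 7] * c[1, 2] * c[3, 4] * c[5, 6],
     c[0, 2] * c[1, 7] * c[3, 5] * c[4, 6],
     c[0, 4] * c[1, 5] * c[2, 6] * c[3, 7],
     c[3, 4] * c[5, 6]} : Set (Equiv.Perm (Fin 8)))) :
    ∃ g : AutData, ∀ j, numbering8T9 (τ j) = g.act (numbering8T9 j) := by
  rcases hτ with rfl | rfl | rfl | rfl <;> decide +kernel

/-- A subgroup of order eight acting regularly on the roots lies in the kernel of one of four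
characters. -/
theorem exists_character_trivial (e : RootIndex → ℤˣ)
    (he : ∀ p q, e (AutData.act (e p, p) q) = e p * e q) :
    (∀ p, e p = 1) ∨ (∀ p : RootIndex, e p * paritySign p.1 * p.2 = 1) ∨
    (∀ p : RootIndex, e p * paritySign p.1 = 1) ∨ (∀ p : RootIndex, e p * p.2 = 1) := by
  -- There are only `2 ^ 8` functions `e` to test.
  revert e; decide +kernel

/-! ### The roots inside a field containing `i`. -/

section
variable {L : Type*} [Field L]

/-- The root `i ^ k * α ^ s`. -/
def indexedRoot (i α : L) (p : RootIndex) : L := i ^ p.1.val * α ^ (p.2 : ℤ)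

theorem zpow_eq_zpow_of_sq_eq_neg_one {i : L} (hi : i ^ 2 = -1) {m n : ℤ}
    (h : (m : ZMod 4) = n) : i ^ m = i ^ n := by
  have hi0 : i ≠ 0 := by rintro rfl; simp at hi
  obtain ⟨c, hc⟩ := (ZMod.intCast_eq_intCast_iff_dvd_sub m n 4).mp h
  have h4 : i ^ (4 : ℤ) = 1 := by
    rw [show (4 : ℤ) = ((2 * 2 : ℕ) : ℤ) by norm_num, zpow_natCast, pow_mul, hi]; norm_num
  obtain rfl : n = m + 4 * c := by push_cast at hc; omega
  rw [zpow_add₀ hi0, zpow_mul, h4, one_zpow, mul_one]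

/-- If `g = (ε, k, s)`, then `i ^ m * α ^ t` goes to `i ^ (ε m) * (i ^ k * α ^ s) ^ t`, and
exponents of `i` matter only mod 4. -/
theorem map_indexedRoot {F : Type*} [FunLike F L L] [RingHomClass F L L] (σ : F) {i α : L}
    (hi : i ^ 2 = -1) (g : AutData) (hσi : σ i = i ^ (g.1 : ℤ))
    (hσα : σ α = indexedRoot i α g.2) (p : RootIndex) :
    σ (indexedRoot i α p) = indexedRoot i α (g.act p) := by
  have hi0 : i ≠ 0 := by rintro rfl; simp at hi
  simp only [indexedRoot, AutData.act] at *
  rw [map_mul, map_pow, map_zpow₀, hσi, hσα, mul_zpow, ← zpow_mul, ← zpow_natCast, ← zpow_mul,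
    ← zpow_natCast i, ← zpow_mul, ← mul_assoc, ← zpow_add₀ hi0, Units.val_mul, ← zpow_natCast i]
  congr 1
  apply zpow_eq_zpow_of_sq_eq_neg_one hi
  push_cast
  simp [mul_comm]

theorem exists_indexedRoot_eq {i α x : L} {a : L} (hi : i ^ 2 = -1) (hα : α ≠ 0)
    (hαa : α ^ 8 + a * α ^ 4 + 1 = 0) (hx : x ^ 8 + a * x ^ 4 + 1 = 0) :
    ∃ p, indexedRoot i α p = x := by
  have aux : ∀ y z : L, z ≠ 0 → y ^ 4 = z ^ 4 → ∃ k : ZMod 4, i ^ k.val * z = y := by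
    intro y z hz h
    have : (y - z) * (y + z) * ((y - i * z) * (y + i * z)) = 0 := by
      linear_combination h - (y ^ 2 - z ^ 2) * z ^ 2 * hi
    rcases mul_eq_zero.mp this with h | h <;> rcases mul_eq_zero.mp h with h | h
    · exact ⟨0, by rw [show (0 : ZMod 4).val = 0 from rfl]; linear_combination -h⟩
    · exact ⟨2, by rw [show (2 : ZMod 4).val = 2 from rfl, hi]; linear_combination -h⟩
    · exact ⟨1, by rw [show (1 : ZMod 4).val = 1 from rfl]; linear_combination -h⟩
    · exact ⟨3, by
        rw [show (3 : ZMod 4).val = 3 from rfl]; linear_combination -h + i * z * hi⟩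
  -- The octic is a quadratic in `x ^ 4` whose roots have product 1, so `x ^ 4` is `α ^ 4` or its
  -- inverse.
  have h0 : (x ^ 4 - α ^ 4) * (x ^ 4 * α ^ 4 - 1) = 0 := by
    linear_combination α ^ 4 * hx - x ^ 4 * hαa
  rcases mul_eq_zero.mp h0 with h | h
  · obtain ⟨k, hk⟩ := aux x α hα (sub_eq_zero.mp h)
    exact ⟨(k, 1), by simpa [indexedRoot] using hk⟩
  · obtain ⟨k, hk⟩ := aux x α⁻¹ (inv_ne_zero hα)
      (by rw [inv_pow]; exact eq_inv_of_mul_eq_one_left (sub_eq_zero.mp h))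
    exact ⟨(k, -1), by simpa [indexedRoot] using hk⟩

end

/-- The two hypotheses give the two inclusions; the second is needed only on generators, since the
image of the Galois group is a subgroup. -/
theorem hasGaloisType_of_numbering {K : Type*} [Field K] {f : K[X]} {n : ℕ}
    (e : f.rootSet f.SplittingField ≃ Fin n) (G : Set (Equiv.Perm (Fin n)))
    (h₁ : ∀ σ : f.Gal, ∃ τ ∈ Subgroup.closure G, ∀ j, σ (e.symm j) = (e.symm (τ j) : f.SplittingField))
    (h₂ : ∀ τ ∈ G, ∃ σ : f.Gal, ∀ j, σ (e.symm j) = (e.symm (τ j) : f.SplittingField)) :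
    HasGaloisType f (Subgroup.closure G) := by
  have key : ∀ (σ : f.Gal) (τ : Equiv.Perm (Fin n)),
      (∀ j, σ (e.symm j) = (e.symm (τ j) : f.SplittingField)) →
      e.permCongrHom (MulAction.toPermHom f.Gal (f.rootSet f.SplittingField) σ) = τ := by
    intro σ τ h
    ext j
    have : σ • e.symm j = e.symm (τ j) := Subtype.ext (h j)
    simp [Equiv.permCongrHom, this]
  refine ⟨e, le_antisymm ?_ ?_⟩
  · rintro _ ⟨_, ⟨σ, rfl⟩, rfl⟩
    obtain ⟨τ, hτ, h⟩ := h₁ σ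
    have := key σ τ h
    exact this ▸ hτ
  · rw [Subgroup.closure_le]
    intro τ hτ
    obtain ⟨σ, h⟩ := h₂ τ hτ
    exact ⟨_, ⟨σ, rfl⟩, key σ τ h⟩

/-! ### Signs by which automorphisms act on the three square roots. -/

section
variable {L : Type*} [Field L] {F : Type*} [FunLike F L L]

/-- `σ` maps `i` to `i ^ ε` and `α` to `i ^ k * α ^ s`, where `g = (ε, k, s)`. -/
def Realizes (i α : L) (σ : F) (g : AutData) : Prop :=
  σ i = i ^ (g.1 : ℤ) ∧ σ α = indexedRoot i α g.2

variable [RingHomClass F L L] {i α : L} {σ : F} {g : AutData}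

omit [RingHomClass F L L] in
theorem Realizes.map_I (h : Realizes i α σ g) (hi : i ^ 2 = -1) : σ i = ((g.1 : ℤ) : L) * i := by
  rw [h.1]
  rcases Int.units_eq_one_or g.1 with h | h <;> rw [h]
  · simp
  · have hi0 : i ≠ 0 := by rintro rfl; simp at hi
    simp only [Units.val_neg, Units.val_one, zpow_neg, zpow_one, Int.cast_neg, Int.cast_one]
    rw [inv_eq_of_mul_eq_one_left (b := i) (a := -i) (by linear_combination -hi)]
    ring

theorem Realizes.map_sq (h : Realizes i α σ g) (hi : i ^ 2 = -1) :
    σ (α ^ 2) = ((paritySign g.2.1 : ℤ) : L) * (α ^ 2) ^ (g.2.2 : ℤ) := by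
  rw [map_pow, h.2, indexedRoot, mul_pow, ← pow_mul, mul_comm _ 2, pow_mul, hi,
    ← zpow_natCast (α ^ (g.2.2 : ℤ)), zpow_comm, zpow_natCast, paritySign]
  simp

theorem units_cast_mul_self (u : ℤˣ) : ((u : ℤ) : L) * ((u : ℤ) : L) = 1 := by
  rw [← Int.cast_mul, ← Units.val_mul, Int.units_mul_self]; simp

/-- Since `α²` goes to `(-1)^k α^(2s)`, inversion contributes the extra sign `s` to the difference,
but none to the sum. -/
theorem Realizes.map_sub (h : Realizes i α σ g) (hi : i ^ 2 = -1) :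
    σ (i * (α ^ 2 - (α ^ 2)⁻¹)) =
      (((g.1 * paritySign g.2.1 * g.2.2 : ℤˣ) : ℤ) : L) * (i * (α ^ 2 - (α ^ 2)⁻¹)) := by
  rw [map_mul, _root_.map_sub σ (α ^ 2), map_inv₀, h.map_sq hi, h.map_I hi]
  have hu := inv_eq_of_mul_eq_one_left (units_cast_mul_self (L := L) (paritySign g.2.1))
  rcases Int.units_eq_one_or g.2.2 with h | h <;> rw [h] <;> simp [hu] <;> ring

theorem Realizes.map_add (h : Realizes i α σ g) (hi : i ^ 2 = -1) :
    σ (i * (α ^ 2 + (α ^ 2)⁻¹)) =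
      (((g.1 * paritySign g.2.1 : ℤˣ) : ℤ) : L) * (i * (α ^ 2 + (α ^ 2)⁻¹)) := by
  rw [map_mul, _root_.map_add σ (α ^ 2), map_inv₀, h.map_sq hi, h.map_I hi]
  have hu := inv_eq_of_mul_eq_one_left (units_cast_mul_self (L := L) (paritySign g.2.1))
  rcases Int.units_eq_one_or g.2.2 with h | h <;> rw [h] <;> simp [hu] <;> ring

/-- Passing to `α⁴` squares the parity sign away. -/
theorem Realizes.map_fourth_sub (h : Realizes i α σ g) (hi : i ^ 2 = -1) :
    σ (i * ((α ^ 2) ^ 2 - ((α ^ 2) ^ 2)⁻¹)) =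
      (((g.1 * g.2.2 : ℤˣ) : ℤ) : L) * (i * ((α ^ 2) ^ 2 - ((α ^ 2) ^ 2)⁻¹)) := by
  rw [map_mul, _root_.map_sub σ ((α ^ 2) ^ 2), map_inv₀, map_pow σ (α ^ 2), h.map_sq hi, h.map_I hi,
    mul_pow, sq ((paritySign g.2.1 : ℤ) : L), units_cast_mul_self, one_mul]
  rcases Int.units_eq_one_or g.2.2 with h | h <;> rw [h] <;> simp <;> ring

omit [RingHomClass F L L] in
theorem Realizes.eq_one_of_map_eq_self [CharZero L] {x : L} (hx : x ≠ 0) {u : ℤˣ}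
    (h : σ x = ((u : ℤ) : L) * x) (hfix : σ x = x) : u = 1 := by
  rcases Int.units_eq_one_or u with rfl | rfl
  · rfl
  · rw [h] at hfix
    simp only [Units.val_neg, Units.val_one, Int.cast_neg, Int.cast_one, neg_mul, one_mul] at hfix
    exact absurd (self_eq_neg.mp hfix.symm) hx

end

theorem sq_eq_algebraMap_fixed {K L : Type*} [Field K] [Field L] [Algebra K L] {F : Type*}
    [FunLike F L L] [AlgHomClass F K L L] {x : L} {c : K} (hx : x ^ 2 = algebraMap K L c)
    (hc : IsSquare c) (σ : F) : σ x = x := by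
  obtain ⟨r, rfl⟩ := hc
  have : (x - algebraMap K L r) * (x + algebraMap K L r) = 0 := by
    rw [map_mul] at hx; linear_combination hx
  rcases mul_eq_zero.mp this with h | h
  · rw [sub_eq_zero.mp h, AlgHomClass.commutes]
  · rw [eq_neg_of_add_eq_zero_left h, map_neg, AlgHomClass.commutes]

/-! ### The splitting field of the octic and its automorphisms. -/

section
variable {K : Type*} [Field K] {a : K} {f : K[X]}

theorem natDegree_octic (hfa : f = X ^ 8 + C a * X ^ 4 + 1) : f.natDegree = 8 := by
  rw [hfa]; compute_degree!

theorem mem_rootSet_octic (hfa : f = X ^ 8 + C a * X ^ 4 + 1) {x : f.SplittingField} :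
    x ∈ f.rootSet f.SplittingField ↔ x ^ 8 + algebraMap K _ a * x ^ 4 + 1 = 0 := by
  have h0 : f ≠ 0 := fun h => by simpa [h] using natDegree_octic hfa
  simp only [mem_rootSet, ne_eq, h0, not_false_eq_true, true_and]
  simp [hfa]

theorem exists_root_exists_I (hfa : f = X ^ 8 + C a * X ^ 4 + 1) :
    ∃ α i : f.SplittingField, α ^ 8 + algebraMap K _ a * α ^ 4 + 1 = 0 ∧ i ^ 2 = -1 := by
  have hs := SplittingField.splits f
  have hd : (f.map (algebraMap K f.SplittingField)).natDegree = 8 := by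
    rw [natDegree_map, natDegree_octic hfa]
  have h0 : f.map (algebraMap K f.SplittingField) ≠ 0 := fun h => by simp [h] at hd
  obtain ⟨α, hα⟩ := hs.exists_eval_eq_zero (fun h => by
    have := natDegree_eq_zero_iff_degree_le_zero.mpr h.le
    omega)
  have hα' : α ^ 8 + algebraMap K f.SplittingField a * α ^ 4 + 1 = 0 := by
    simpa [hfa] using hα
  have hα0 : α ≠ 0 := by rintro rfl; simp at hα'
  -- Evenness in `X ^ 2` puts a root `β` of `X ^ 2 + α ^ 2` in the splitting field, and `β / α`
  -- serves as `i`.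
  have hdvd : (X ^ 2 + C (α ^ 2) : f.SplittingField[X]) ∣
      f.map (algebraMap K f.SplittingField) := by
    refine ⟨(X ^ 2 - C (α ^ 2)) * (X ^ 4 + C (algebraMap K _ a + α ^ 4)), ?_⟩
    have : (C (α ^ 8 + algebraMap K f.SplittingField a * α ^ 4 + 1) :
      f.SplittingField[X]) = 0 := by rw [hα', C_0]
    have hm := congrArg (Polynomial.map (algebraMap K f.SplittingField)) hfa
    simp only [Polynomial.map_add, Polynomial.map_mul, Polynomial.map_pow, map_X, map_C,
      Polynomial.map_one, C_add, C_mul, C_pow, C_1] at this hm ⊢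
    linear_combination hm + this
  have hd2 : (X ^ 2 + C (α ^ 2) : f.SplittingField[X]).degree = 2 := by compute_degree!
  obtain ⟨β, hβ⟩ := (hs.of_dvd h0 hdvd).exists_eval_eq_zero (by rw [hd2]; decide)
  have hβ' : β ^ 2 + α ^ 2 = 0 := by simpa using hβ
  refine ⟨α, β / α, hα', ?_⟩
  field_simp
  linear_combination hβ'

variable [CharZero K] {α i : f.SplittingField}

/-- Separability gives eight roots, all covered by eight indices, so counting forces a bijection. -/
theorem indexedRoot_bijOn (hf : Irreducible f) (hfa : f = X ^ 8 + C a * X ^ 4 + 1)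
    (hα : α ^ 8 + algebraMap K _ a * α ^ 4 + 1 = 0) (hi : i ^ 2 = -1) :
    Function.Injective (indexedRoot i α) ∧
      Set.range (indexedRoot i α) = f.rootSet f.SplittingField := by
  have hα0 : α ≠ 0 := by rintro rfl; simp at hα
  have hsub : f.rootSet f.SplittingField ⊆ Set.range (indexedRoot i α) := fun x hx =>
    exists_indexedRoot_eq hi hα0 hα ((mem_rootSet_octic hfa).mp hx)
  have hcard : (f.rootSet f.SplittingField).ncard = 8 := by
    rw [← Nat.card_coe_set_eq, Nat.card_eq_fintype_card,
      card_rootSet_eq_natDegree hf.separable (SplittingField.splits _), natDegree_octic hfa]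
  have hR : Nat.card RootIndex = 8 := by rw [Nat.card_eq_fintype_card]; rfl
  have hle : (Set.range (indexedRoot i α)).ncard ≤ 8 := by
    rw [← Set.image_univ, ← hR, ← Set.ncard_univ]; exact Set.ncard_image_le
  have heq := Set.eq_of_subset_of_ncard_le hsub (by rw [hcard]; exact hle)
  refine ⟨?_, heq.symm⟩
  rw [← Set.injOn_univ]
  refine Set.injOn_of_ncard_image_eq ?_
  rw [Set.image_univ, ← heq, hcard, Set.ncard_univ, hR]

theorem exists_realizes (hf : Irreducible f) (hfa : f = X ^ 8 + C a * X ^ 4 + 1)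
    (hα : α ^ 8 + algebraMap K _ a * α ^ 4 + 1 = 0) (hi : i ^ 2 = -1) (σ : f.Gal) :
    ∃ g, Realizes i α σ g := by
  have h1 : σ α ∈ Set.range (indexedRoot i α) := by
    rw [(indexedRoot_bijOn hf hfa hα hi).2, mem_rootSet_octic hfa]
    have := congrArg σ hα
    simpa [show σ (algebraMap K _ a) = algebraMap K _ a from AlgEquiv.commutes σ a] using this
  obtain ⟨p, hp⟩ := h1
  have h2 : (σ i - i) * (σ i + i) = 0 := by
    have := congrArg σ hi
    simp only [map_pow, map_neg, map_one] at this
    linear_combination this - hi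
  rcases mul_eq_zero.mp h2 with h | h
  · exact ⟨(1, p), by simpa using sub_eq_zero.mp h, hp.symm⟩
  · have hi0 : i ≠ 0 := by rintro rfl; simp at hi
    refine ⟨(-1, p), ?_, hp.symm⟩
    simp only [Units.val_neg, Units.val_one, zpow_neg, zpow_one]
    field_simp
    linear_combination i * h - hi

/-- This is transitivity on the roots: all of them share one minimal polynomial up to the leading
coefficient. The sign `ε` is not controlled. -/
theorem exists_gal_realizes (hf : Irreducible f) (hfa : f = X ^ 8 + C a * X ^ 4 + 1)
    (hα : α ^ 8 + algebraMap K _ a * α ^ 4 + 1 = 0) (hi : i ^ 2 = -1) (p : RootIndex) :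
    ∃ (σ : f.Gal) (ε : ℤˣ), Realizes i α σ (ε, p) := by
  have hp : indexedRoot i α p ∈ f.rootSet f.SplittingField := by
    rw [← (indexedRoot_bijOn hf hfa hα hi).2]; exact ⟨p, rfl⟩
  have hx := minpoly.eq_of_irreducible hf (mem_rootSet.mp hp).2
  have hy := minpoly.eq_of_irreducible hf (mem_rootSet.mp ((mem_rootSet_octic hfa).mpr hα)).2
  obtain ⟨σ, hσ⟩ := (Normal.minpoly_eq_iff_mem_orbit f.SplittingField).mp (hx.symm.trans hy)
  obtain ⟨g, hg⟩ := exists_realizes hf hfa hα hi (σ : f.Gal)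
  have : g.2 = p := (indexedRoot_bijOn hf hfa hα hi).1 (hg.2.symm.trans hσ)
  exact ⟨σ, g.1, this ▸ hg⟩

/-! ### Criteria identifying the Galois group. -/

theorem hasGaloisType_of_realizes (hf : Irreducible f) (hfa : f = X ^ 8 + C a * X ^ 4 + 1)
    (hα : α ^ 8 + algebraMap K _ a * α ^ 4 + 1 = 0) (hi : i ^ 2 = -1)
    {ν : Fin 8 → RootIndex} (hν : Function.Injective ν) {G : Set (Equiv.Perm (Fin 8))}
    (h₁ : ∀ (σ : f.Gal) (g), Realizes i α σ g → g.ActsIn ν (Subgroup.closure G))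
    (h₂ : ∀ τ ∈ G, ∃ g, (∃ σ : f.Gal, Realizes i α σ g) ∧ ∀ j, ν (τ j) = g.act (ν j)) :
    HasGaloisType f (Subgroup.closure G) := by
  obtain ⟨hinj, hrange⟩ := indexedRoot_bijOn hf hfa hα hi
  have hνb : Function.Bijective ν :=
    (Fintype.bijective_iff_injective_and_card ν).mpr ⟨hν, by rfl⟩
  let e : f.rootSet f.SplittingField ≃ Fin 8 :=
    ((Equiv.ofBijective ν hνb).trans
      ((Equiv.ofInjective _ hinj).trans (Equiv.setCongr hrange))).symm
  have he : ∀ j, (e.symm j : f.SplittingField) = indexedRoot i α (ν j) := fun j => rfl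
  have hmap : ∀ (σ : f.Gal) (g) (τ : Equiv.Perm (Fin 8)), Realizes i α σ g →
      (∀ j, ν (τ j) = g.act (ν j)) → ∀ j, σ (e.symm j) = (e.symm (τ j) : f.SplittingField) := by
    intro σ g τ hσ h j
    rw [he, he, h, map_indexedRoot σ hi g hσ.1 hσ.2]
  refine hasGaloisType_of_numbering e G (fun σ => ?_) (fun τ hτ => ?_)
  · obtain ⟨g, hg⟩ := exists_realizes hf hfa hα hi σ
    obtain ⟨τ, hτ, h⟩ := h₁ σ g hg
    exact ⟨τ, hτ, hmap σ g τ hg h⟩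
  · obtain ⟨g, ⟨σ, hσ⟩, h⟩ := h₂ τ hτ
    exact ⟨σ, hmap σ g τ hσ h⟩

/-- The case in which a character `χ`, linear in the first coordinate, cuts out the Galois group. -/
theorem hasGaloisType_of_character (hf : Irreducible f) (hfa : f = X ^ 8 + C a * X ^ 4 + 1)
    (hα : α ^ 8 + algebraMap K _ a * α ^ 4 + 1 = 0) (hi : i ^ 2 = -1)
    {ν : Fin 8 → RootIndex} (hν : Function.Injective ν) {G : Set (Equiv.Perm (Fin 8))}
    (χ : RootIndex → ℤˣ) (hχ : ∀ (σ : f.Gal) (g), Realizes i α σ g → g.1 * χ g.2 = 1)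
    (h₁ : ∀ g : AutData, g.1 * χ g.2 = 1 → g.ActsIn ν (Subgroup.closure G))
    (h₂ : ∀ τ ∈ G, ∃ g : AutData, g.1 * χ g.2 = 1 ∧ ∀ j, ν (τ j) = g.act (ν j)) :
    HasGaloisType f (Subgroup.closure G) := by
  refine hasGaloisType_of_realizes hf hfa hα hi hν (fun σ g h => h₁ g (hχ σ g h)) (fun τ hτ => ?_)
  obtain ⟨g, hg, h⟩ := h₂ τ hτ
  obtain ⟨σ, ε, hσ⟩ := exists_gal_realizes hf hfa hα hi g.2
  -- Transitivity supplies the right `(k, s)`; the character equation then leaves one possible `ε`.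
  have : ε = g.1 := mul_right_cancel ((hχ σ _ hσ).trans hg.symm)
  subst this
  exact ⟨g, ⟨σ, hσ⟩, h⟩

omit [CharZero K] in
theorem Realizes.mul (hi : i ^ 2 = -1) {σ σ' : f.Gal} {g g' : AutData}
    (h : Realizes i α σ g) (h' : Realizes i α σ' g') :
    Realizes i α (σ * σ') (g.1 * g'.1, g.act g'.2) := by
  constructor
  · change σ (σ' i) = _
    rw [h'.1, map_zpow₀, h.1, ← zpow_mul]
    rfl
  · change σ (σ' α) = _
    rw [h'.2, map_indexedRoot σ hi g h.1 h.2]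

theorem isSquare_of_fixed (hf : Irreducible f) {x : f.SplittingField} {c : K} (hx : x ^ 2 = algebraMap K _ c)
    (hfix : ∀ σ : f.Gal, σ x = x) : IsSquare c := by
  have : IsGalois K f.SplittingField :=
    IsGalois.of_separable_splitting_field hf.separable
  obtain ⟨r, hr⟩ := (IsGalois.mem_range_algebraMap_iff_fixed x).mpr hfix
  refine ⟨r, (algebraMap K f.SplittingField).injective ?_⟩
  rw [← hx, ← hr, map_mul, sq]

/-- Either every `(ε, k, s)` is realized by an automorphism, or the automorphisms lie in the kernel
of a character. -/
theorem exists_realizes_or_character (hf : Irreducible f) (hfa : f = X ^ 8 + C a * X ^ 4 + 1)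
    (hα : α ^ 8 + algebraMap K _ a * α ^ 4 + 1 = 0) (hi : i ^ 2 = -1) :
    (∀ g, ∃ σ : f.Gal, Realizes i α σ g) ∨
    (∀ (σ : f.Gal) (g), Realizes i α σ g → g.1 = 1) ∨
    (∀ (σ : f.Gal) (g), Realizes i α σ g → g.1 * paritySign g.2.1 * g.2.2 = 1) ∨
    (∀ (σ : f.Gal) (g), Realizes i α σ g → g.1 * paritySign g.2.1 = 1) ∨
    (∀ (σ : f.Gal) (g), Realizes i α σ g → g.1 * g.2.2 = 1) := by
  -- The index `(0, 1)` is that of `α` itself.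
  have hact : ∀ g : AutData, g.act (0, 1) = g.2 := by decide
  choose s e hs using exists_gal_realizes hf hfa hα hi
  -- The triple `(-1, 0, 1)` is the only possible nontrivial automorphism fixing `α`. If it occurs,
  -- composing with it flips `ε` and everything is realized.
  by_cases hc : ∃ σ : f.Gal, Realizes i α σ (-1, 0, 1)
  · left
    intro g
    obtain ⟨σ, hσ⟩ := hc
    by_cases hg : e g.2 = g.1
    · exact ⟨s g.2, by simpa [hg] using hs g.2⟩
    · refine ⟨s g.2 * σ, ?_⟩
      have := (hs g.2).mul hi hσ
      rw [hact] at this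
      rwa [mul_neg_one, ← Int.units_ne_iff_eq_neg.mp (Ne.symm hg)] at this
  · right
    -- Two automorphisms with the same `(k, s)` but opposite `ε` would differ by the excluded one.
    have huniq : ∀ (σ : f.Gal) g, Realizes i α σ g → e g.2 = g.1 := by
      intro σ g hσ
      by_contra hg
      apply hc
      refine ⟨(s g.2)⁻¹ * σ, ?_, ?_⟩
      · change (s g.2)⁻¹ (σ i) = _
        have hsi : (s g.2)⁻¹ (s g.2 i) = i := AlgEquiv.symm_apply_apply (s g.2) i
        rw [hσ.map_I hi, Int.units_ne_iff_eq_neg.mp (Ne.symm hg)]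
        rw [(hs g.2).map_I hi] at hsi
        have hi0 : i ≠ 0 := by rintro rfl; simp at hi
        simp only [Units.val_neg, Int.cast_neg, neg_mul, map_neg, hsi, Units.val_one, zpow_neg,
          zpow_one]
        field_simp
        linear_combination -hi
      · change (s g.2)⁻¹ (σ α) = _
        rw [hσ.2, ← (hs g.2).2]
        have : (s g.2)⁻¹ (s g.2 α) = α := AlgEquiv.symm_apply_apply (s g.2) α
        rw [this]
        simp [indexedRoot]
    have he : ∀ p q, e (AutData.act (e p, p) q) = e p * e q := fun p q =>
      huniq _ _ ((hs p).mul hi (hs q))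
    rcases exists_character_trivial e he with h | h | h | h
    · exact Or.inl fun σ g hg => huniq σ g hg ▸ h g.2
    · exact Or.inr (Or.inl fun σ g hg => huniq σ g hg ▸ h g.2)
    · exact Or.inr (Or.inr (Or.inl fun σ g hg => huniq σ g hg ▸ h g.2))
    · exact Or.inr (Or.inr (Or.inr fun σ g hg => huniq σ g hg ▸ h g.2))

/-! ### The four cases, over any field of characteristic zero in which `-1` is not a square. -/

theorem hasGaloisType_octic (hneg : ¬ IsSquare (-1 : K)) (hf : Irreducible f)
    (hfa : f = X ^ 8 + C a * X ^ 4 + 1) :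
    (IsSquare (a + 2) → HasGaloisType f group8T3) ∧
    (¬ IsSquare (a + 2) → IsSquare (a - 2) → HasGaloisType f group8T4) ∧
    (¬ IsSquare (a + 2) → ¬ IsSquare (a - 2) → IsSquare (4 - a ^ 2) →
      HasGaloisType f group8T2) ∧
    (¬ IsSquare (a + 2) → ¬ IsSquare (a - 2) → ¬ IsSquare (4 - a ^ 2) →
      HasGaloisType f group8T9) := by
  obtain ⟨α, i, hα, hi⟩ := exists_root_exists_I hfa
  have hα0 : α ≠ 0 := by rintro rfl; simp at hα
  have hfour : ∀ x : K, (X ^ 4 + C x : K[X]).natDegree = 4 := fun x => by compute_degree!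
  have hnot : ∀ x y : K,
      f ≠ (X ^ 4 + C x) * (X ^ 4 + C y) := by
    intro x y h
    rcases hf.isUnit_or_isUnit h with h | h <;>
      simpa [hfour] using natDegree_eq_zero_of_isUnit h
  -- For `a = -2` and `a = 2` the octic is the square of `X ^ 4 - 1` and `X ^ 4 + 1`. Excluding
  -- these keeps all three `δ` nonzero, so the signs acting on them are well determined.
  have ha2 : a + 2 ≠ 0 := fun h => hnot (-1) (-1) (by
    rw [hfa, eq_neg_of_add_eq_zero_left h]; simp [C_ofNat]; ring)
  have ha2' : a - 2 ≠ 0 := fun h => hnot 1 1 (by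
    rw [hfa, sub_eq_zero.mp h]; simp [C_ofNat]; ring)
  set δ₁ := i * (α ^ 2 - (α ^ 2)⁻¹) with hδ₁
  set δ₂ := i * (α ^ 2 + (α ^ 2)⁻¹) with hδ₂
  set δ₃ := i * ((α ^ 2) ^ 2 - ((α ^ 2) ^ 2)⁻¹) with hδ₃
  have h₁ : δ₁ ^ 2 = algebraMap K _ (a + 2) := by
    rw [hδ₁, mul_pow, hi]
    field_simp
    simp only [map_add, map_ofNat]
    linear_combination -hα
  have h₂ : δ₂ ^ 2 = algebraMap K _ (a - 2) := by
    rw [hδ₂, mul_pow, hi]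
    field_simp
    simp only [map_sub, map_ofNat]
    linear_combination -hα
  have h₃ : δ₃ ^ 2 = algebraMap K _ (4 - a ^ 2) := by
    rw [hδ₃, mul_pow, hi]
    field_simp
    simp only [map_sub, map_pow, map_ofNat]
    linear_combination (-(α ^ 8 + 1) + algebraMap K _ a * α ^ 4) * hα
  have n₁ : δ₁ ≠ 0 := by
    intro h; rw [h, zero_pow two_ne_zero] at h₁
    exact ha2 ((map_eq_zero _).mp h₁.symm)
  have n₂ : δ₂ ≠ 0 := by
    intro h; rw [h, zero_pow two_ne_zero] at h₂
    exact ha2' ((map_eq_zero _).mp h₂.symm)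
  have n₃ : δ₃ ≠ 0 := by
    intro h; rw [h, zero_pow two_ne_zero] at h₃
    have := (map_eq_zero _).mp h₃.symm
    exact mul_ne_zero ha2 ha2' (by linear_combination -this)
  refine ⟨fun hs => ?_, fun _ hs => ?_, fun _ _ hs => ?_, fun hs₁ hs₂ hs₃ => ?_⟩
  · refine hasGaloisType_of_character hf hfa hα hi numbering8T3_injective
      (fun p => paritySign p.1 * p.2) (fun σ g hg => ?_) (fun g hg => ?_) (fun τ hτ => ?_)
    · rw [← mul_assoc]
      exact Realizes.eq_one_of_map_eq_self n₁ (hg.map_sub hi) (sq_eq_algebraMap_fixed h₁ hs σ)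
    · exact actsIn_group8T3 g (by rwa [← mul_assoc] at hg)
    · simpa only [mul_assoc] using group8T3_generators τ hτ
  · exact hasGaloisType_of_character hf hfa hα hi numbering8T4_injective (fun p => paritySign p.1)
      (fun σ g hg =>
        Realizes.eq_one_of_map_eq_self n₂ (hg.map_add hi) (sq_eq_algebraMap_fixed h₂ hs σ))
      actsIn_group8T4 group8T4_generators
  · exact hasGaloisType_of_character hf hfa hα hi numbering8T2_injective (fun p => p.2)
      (fun σ g hg =>
        Realizes.eq_one_of_map_eq_self n₃ (hg.map_fourth_sub hi) (sq_eq_algebraMap_fixed h₃ hs σ))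
      actsIn_group8T2 group8T2_generators
  -- A square root of `c` on which all signs are trivial is Galois-fixed, hence lies in `K`. Each of
  -- the four characters is ruled out this way.
  · have hsq : ∀ (x : f.SplittingField) (c : K)
        (u : AutData → ℤˣ), x ^ 2 = algebraMap K _ c →
        (∀ (σ : f.Gal) (g), Realizes i α σ g →
          σ x = ((u g : ℤ) : f.SplittingField) * x) →
        (∀ (σ : f.Gal) (g), Realizes i α σ g → u g = 1) →
        IsSquare c := by
      intro x c u hx hu h1
      refine isSquare_of_fixed hf hx fun σ => ?_
      obtain ⟨g, hg⟩ := exists_realizes hf hfa hα hi σ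
      rw [hu σ g hg, h1 σ g hg]
      simp
    rcases exists_realizes_or_character hf hfa hα hi with h | h | h | h | h
    · refine hasGaloisType_of_realizes hf hfa hα hi numbering8T9_injective
        (fun _ g _ => actsIn_group8T9 g) (fun τ hτ => ?_)
      obtain ⟨g, hg⟩ := group8T9_generators τ hτ
      exact ⟨g, h g, hg⟩
    · exact absurd (hsq i (-1) (fun g => g.1) (by simp [hi]) (fun σ g hg => hg.map_I hi) h) hneg
    · exact absurd (hsq _ _ _ h₁ (fun σ g hg => hg.map_sub hi) h) hs₁
    · exact absurd (hsq _ _ _ h₂ (fun σ g hg => hg.map_add hi) h) hs₂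
    · exact absurd (hsq _ _ _ h₃ (fun σ g hg => hg.map_fourth_sub hi) h) hs₃

end

theorem corollary3p6 (a : ℚ)
    (hf : Irreducible (X ^ 8 + C a * X ^ 4 + 1 : ℚ[X])) :
    (IsSquare (a + 2) →
      HasGaloisType (X ^ 8 + C a * X ^ 4 + 1 : ℚ[X]) group8T3) ∧
    (¬ IsSquare (a + 2) → IsSquare (a - 2) →
      HasGaloisType (X ^ 8 + C a * X ^ 4 + 1 : ℚ[X]) group8T4) ∧
    (¬ IsSquare (a + 2) → ¬ IsSquare (a - 2) → IsSquare (4 - a ^ 2) →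
      HasGaloisType (X ^ 8 + C a * X ^ 4 + 1 : ℚ[X]) group8T2) ∧
    (¬ IsSquare (a + 2) → ¬ IsSquare (a - 2) → ¬ IsSquare (4 - a ^ 2) →
      HasGaloisType (X ^ 8 + C a * X ^ 4 + 1 : ℚ[X]) group8T9) := by
  refine hasGaloisType_octic ?_ hf rfl
  rintro ⟨r, hr⟩
  linarith [mul_self_nonneg r]
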